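/- Let $\mathbb N=\{1,2,3,\dots\}$ and let $A$ be the renewal matrix on $\mathbb N$: $A(1,n)=A(n+1,n)=1$ for all $n\in\mathbb N$, all other entries $0$. Let $\Sigma_A=\{x\in\mathbb N^{\mathbb N_0}: A(x_n,x_{n+1})=1\ \forall n\}$, and for $s\in\mathbb N$ let $T_s$ be the partial isometry of $\ell^2(\Sigma_A)$ with $T_s\delta_x=\delta_{sx}$ if $A(s,x_0)=1$ and $T_s\delta_x=0$ otherwise; put $Q_s=T_s^*T_s$. Let $\mathcal D_A$ be the unital commutative $C^*$-algebra generated by the operators $T_\alpha\big(\prod_{i\in F}Q_i\big)T_\alpha^*$ ($\alpha=\alpha_0\cdots\alpha_n$ a finite word, possibly empty, $T_\alpha=T_{\alpha_0}\cdots T_{\alpha_n}$, and $F\subset\mathbb N$ finite). Let $\mathbb F$ be the free group on $\mathbb N$ with identity $e$; for $g\in\mathbb F$ with reduced form $x_1\cdots x_n$ put $T_g=T_{x_1}\cdots T_{x_n}$, where $T_{s^{-1}}=T_s^*$, and $e_g=T_gT_g^*\in\mathcal D_A$. Let $X_A$ be the spectrum of $\mathcal D_A$, identified through $\varphi\mapsto(\varphi(e_g))_{g\in\mathbb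 F}$ with a subspace of $\{0,1\}^{\mathbb F}$ (product topology) and equipped with its Borel $\sigma$-algebra; $\Sigma_A$ is identified with the subset of $X_A$ of the characters $S\mapsto\langle S\delta_x,\delta_x\rangle$, $x\in\Sigma_A$. Put $Y_A=X_A\setminus\Sigma_A$. Let $U\subset X_A$ be the open set of those $\xi$ with $\xi_j=1$ for some letter $j\in\mathbb N$ (there is then only one such $j$), and let $\sigma:U\to X_A$ be the shift, $\sigma(\xi)_g=\xi_{jg}$. Let $R$ be the set consisting of the empty word and of all finite admissible words in $\mathbb N$ whose last letter is $1$, let $\xi^0\in\{0,1\}^{\mathbb F}$ be given by $\xi^0_g=1$ if and only if $g=\omega^{-1}$ for some $\omega\in R$, and let $(\omega\xi^0)_g=\xi^0_{\omega^{-1}g}$ for $\omega\in R$. **Theorem.** The configuration $\xi^0$ is the unique element of $X_A$ in which no letter $j\in\mathbb N$ is filled (so $U=X_A\setminus\{\xi^0\}$), and a finite positive word $\omega$ lies in $R$ if and only if $\xi^0_{\omega^{-1}}=1$. The map $\omega\mapsto\omega\xi^0$ is a bijection from $R$ onto $Y_A$, and $Y_A$ is countable. For every nonempty $\omega\in R$,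 $\omega\xi^0\in U$ and $\sigma(\omega\xi^0)=\sigma(\omega)\xi^0$, where $\sigma(\omega)\in R$ is $\omega$ with its first letter removed. Let $\mu$ be a Borel measure on $X_A$ (values in $[0,\infty]$, not necessarily finite) with $\mu(\Sigma_A)=0$, and let $c_\omega=\mu(\{\omega\xi^0\})$ for $\omega\in R$. Then $$\mu(E)=\sum_{\omega\in R,\ \omega\xi^0\in E}c_\omega\qquad\text{for every Borel set }E\subset X_A.$$ Moreover, for every measurable $D:U\to[0,\infty)$, the measure $\mu$ is $D$-conformal in the sense of Denker–Urbański, that is, $$\mu(\sigma(E))=\int_E D\,d\mu\quad\text{for every Borel set }E\subset U\text{ on which }\sigma\text{ is injective},$$ if and only if $$c_\omega\,D(\omega\xi^0)=c_{\sigma(\omega)}\qquad\text{for all nonempty }\omega\in R$$ (with the convention $0\cdot\infty=0$). -/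

import Mathlib

open MeasureTheory
open scoped ENNReal NNReal

noncomputable section

namespace RenewalShift

/-! ### Countable Markov shifts and the operators `T s` on `ℓ²(Σ_A)`

The alphabet is `ℕ+ = {1, 2, …}`; a `0`-`1` matrix is a relation `A`, where `A i j` means that the
entry `(i, j)` equals `1`. -/

/-- The Markov shift space `Σ_A`. -/
abbrev ShiftSpace (A : ℕ+ → ℕ+ → Prop) : Type :=
  {x : ℕ → ℕ+ // ∀ n, A (x n) (x (n + 1))}

/-- The shift map on `Σ_A`. -/
def seqShift {A : ℕ+ → ℕ+ → Prop} (x : ShiftSpace A) : ShiftSpace A :=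
  ⟨fun n => x.1 (n + 1), fun n => x.2 (n + 1)⟩

/-- The Hilbert space `ℓ²(Σ_A)`. -/
abbrev Hilb (A : ℕ+ → ℕ+ → Prop) : Type := lp (fun _ : ShiftSpace A => ℂ) 2

open Classical in
/-- The canonical basis vector `δ_x` of `ℓ²(Σ_A)`. -/
def basisVec {A : ℕ+ → ℕ+ → Prop} (x : ShiftSpace A) : Hilb A := lp.single 2 x (1 : ℂ)

theorem seqShift_inj {A : ℕ+ → ℕ+ → Prop} {x y : ShiftSpace A} (h0 : x.1 0 = y.1 0)
    (h : seqShift x = seqShift y) : x = y := by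
  apply Subtype.ext
  funext n
  cases n with
  | zero => exact h0
  | succ n => exact congrFun (congrArg Subtype.val h) n

theorem sum_T_le {A : ℕ+ → ℕ+ → Prop} (s : ℕ+) (f : Hilb A) (F : Finset (ShiftSpace A)) :
    ∑ x ∈ F, ‖(if x.1 0 = s then f (seqShift x) else 0 : ℂ)‖ ^ (2 : ℝ≥0∞).toReal
      ≤ ‖f‖ ^ (2 : ℝ≥0∞).toReal := by
  classical
  have h2 : 0 < (2 : ℝ≥0∞).toReal := by norm_num
  calc ∑ x ∈ F, ‖(if x.1 0 = s then f (seqShift x) else 0 : ℂ)‖ ^ (2 : ℝ≥0∞).toReal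
      = ∑ x ∈ F.filter (fun x => x.1 0 = s), ‖f (seqShift x)‖ ^ (2 : ℝ≥0∞).toReal := by
        rw [Finset.sum_filter]
        refine Finset.sum_congr rfl fun x _ => ?_
        split_ifs <;> simp
    _ = ∑ y ∈ (F.filter (fun x => x.1 0 = s)).image seqShift, ‖f y‖ ^ (2 : ℝ≥0∞).toReal := by
        rw [Finset.sum_image]
        intro x hx y hy hxy
        have hx' := (Finset.mem_filter.1 hx).2
        have hy' := (Finset.mem_filter.1 hy).2
        exact seqShift_inj (hx'.trans hy'.symm) hxy
    _ ≤ _ := lp.sum_rpow_le_norm_rpow h2 f _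

/-- The partial isometry `T s` of `ℓ²(Σ_A)`: `T s δ_x = δ_{sx}` if `A s x₀`, and `0` otherwise.
In coordinates, `(T s f) x = f (σ x)` if `x₀ = s`, and `0` otherwise. -/
def T (A : ℕ+ → ℕ+ → Prop) (s : ℕ+) : Hilb A →L[ℂ] Hilb A :=
  LinearMap.mkContinuous
    { toFun := fun f =>
        (⟨fun x => if x.1 0 = s then f (seqShift x) else 0, memℓp_gen' (sum_T_le s f)⟩ : Hilb A)
      map_add' := by
        intro f g
        ext x
        simp only [lp.coeFn_add, Pi.add_apply]
        split_ifs <;> simp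
      map_smul' := by
        intro c f
        ext x
        simp only [lp.coeFn_smul, Pi.smul_apply, RingHom.id_apply]
        split_ifs <;> simp }
    1 (by
      intro f
      rw [one_mul]
      exact lp.norm_le_of_forall_sum_le (by norm_num) (norm_nonneg _) (sum_T_le s f))

/-- `T_α = T_{α₀} ⋯ T_{α_n}` for a finite positive word `α`. -/
def Tword (A : ℕ+ → ℕ+ → Prop) (α : List ℕ+) : Hilb A →L[ℂ] Hilb A :=
  (α.map (T A)).prod

/-- `Q_s = T_s^* T_s`. -/
def Q (A : ℕ+ → ℕ+ → Prop) (s : ℕ+) : Hilb A →L[ℂ] Hilb A := star (T A s) * T A s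

/-- The operators `T_α (∏_{i ∈ F} Q_i) T_α^*` for a finite word `α` and a finite family `F`
(the `Q_i` are commuting projections, so order and repetitions in `F` are irrelevant). -/
def generators (A : ℕ+ → ℕ+ → Prop) : Set (Hilb A →L[ℂ] Hilb A) :=
  {G | ∃ α F : List ℕ+, G = Tword A α * (F.map (Q A)).prod * star (Tword A α)}

/-- The unital commutative `C^*`-algebra generated by `generators A`. -/
def diagAlg (A : ℕ+ → ℕ+ → Prop) : StarSubalgebra ℂ (Hilb A →L[ℂ] Hilb A) :=
  (StarAlgebra.adjoin ℂ (generators A)).topologicalClosure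

/-- `T_g = T_{x₁} ⋯ T_{x_n}`, where `g = x₁ ⋯ x_n` is in reduced form and
`T_{s⁻¹} = T_s^*`. -/
def Tletters (A : ℕ+ → ℕ+ → Prop) (w : List (ℕ+ × Bool)) : Hilb A →L[ℂ] Hilb A :=
  (w.map fun p => if p.2 then T A p.1 else star (T A p.1)).prod

/-- `e_g = T_g T_g^*`. -/
def e (A : ℕ+ → ℕ+ → Prop) (g : FreeGroup ℕ+) : Hilb A →L[ℂ] Hilb A :=
  Tletters A g.toWord * star (Tletters A g.toWord)

/-! ### Facts needed for the definition of `X_A`, of its subset `Σ_A`, and of the shift on it -/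

section Facts

variable {A : ℕ+ → ℕ+ → Prop}

theorem T_apply (s : ℕ+) (f : Hilb A) (x : ShiftSpace A) :
    (T A s f) x = if x.1 0 = s then f (seqShift x) else 0 := rfl

theorem basisVec_self (x : ShiftSpace A) : basisVec x x = 1 := by
  classical
  simp [basisVec]

theorem basisVec_ne {x y : ShiftSpace A} (h : y ≠ x) : basisVec x y = 0 := by
  classical
  simp [basisVec, h]

theorem inner_basisVec (x : ShiftSpace A) (f : Hilb A) : inner ℂ (basisVec x) f = f x := by
  classical
  unfold basisVec
  rw [lp.inner_single_left]
  simp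

theorem star_apply (R : Hilb A →L[ℂ] Hilb A) (f : Hilb A) (x : ShiftSpace A) :
    (star R f) x = inner ℂ (R (basisVec x)) f := by
  rw [← inner_basisVec, ContinuousLinearMap.star_eq_adjoint,
    ContinuousLinearMap.adjoint_inner_right]

/-- The sequence `s x` obtained by putting the letter `s` in front of `x`. -/
def consSeq (s : ℕ+) (x : ShiftSpace A) (h : A s (x.1 0)) : ShiftSpace A :=
  ⟨fun n => Nat.casesOn n s x.1, fun n => by
    cases n with
    | zero => exact h
    | succ n => exact x.2 n⟩

theorem consSeq_zero (s : ℕ+) (x : ShiftSpace A) (h : A s (x.1 0)) :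
    (consSeq s x h).1 0 = s := rfl

theorem T_basisVec (s : ℕ+) (x : ShiftSpace A) (h : A s (x.1 0)) :
    T A s (basisVec x) = basisVec (consSeq s x h) := by
  ext y
  rw [T_apply]
  by_cases hy : y = consSeq s x h
  · subst hy
    rw [if_pos (consSeq_zero s x h), basisVec_self]
    exact basisVec_self x
  · rw [basisVec_ne hy]
    split_ifs with h0
    · refine basisVec_ne fun hx => hy (seqShift_inj h0 ?_)
      rw [hx]
      rfl
    · rfl

theorem T_basisVec_zero (s : ℕ+) (x : ShiftSpace A) (h : ¬ A s (x.1 0)) :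
    T A s (basisVec x) = 0 := by
  ext y
  rw [T_apply]
  split_ifs with h0
  · refine basisVec_ne fun hx => h ?_
    rw [← hx, ← h0]
    exact y.2 0
  · rfl

theorem star_T_apply (s : ℕ+) (f : Hilb A) (x : ShiftSpace A) (h : A s (x.1 0)) :
    (star (T A s) f) x = f (consSeq s x h) := by
  rw [star_apply, T_basisVec s x h, inner_basisVec]

theorem star_T_apply_zero (s : ℕ+) (f : Hilb A) (x : ShiftSpace A) (h : ¬ A s (x.1 0)) :
    (star (T A s) f) x = 0 := by
  rw [star_apply, T_basisVec_zero s x h, inner_zero_left]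

theorem consSeq_seqShift (x : ShiftSpace A) (h : A (x.1 0) ((seqShift x).1 0)) :
    consSeq (x.1 0) (seqShift x) h = x := seqShift_inj rfl rfl

theorem Q_apply (s : ℕ+) (f : Hilb A) (x : ShiftSpace A) [Decidable (A s (x.1 0))] :
    (Q A s f) x = if A s (x.1 0) then f x else 0 := by
  unfold Q
  rw [mul_apply_eq_comp]
  split_ifs with h
  · rw [star_T_apply s _ x h, T_apply, if_pos (consSeq_zero s x h)]
    rfl
  · exact star_T_apply_zero s _ x h

theorem T_mul_star_T_apply (s : ℕ+) (f : Hilb A) (x : ShiftSpace A) :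
    ((T A s * star (T A s)) f) x = if x.1 0 = s then f x else 0 := by
  rw [mul_apply_eq_comp, T_apply]
  split_ifs with h
  · subst h
    have h' : A (x.1 0) ((seqShift x).1 0) := x.2 0
    rw [star_T_apply _ _ _ h', consSeq_seqShift]
  · rfl

theorem Q_mul_T_pos {i j : ℕ+} (h : A i j) : Q A i * T A j = T A j := by
  classical
  ext f x
  rw [mul_apply_eq_comp, Q_apply, T_apply]
  by_cases h0 : x.1 0 = j
  · rw [if_pos (h0 ▸ h)]
  · simp [h0]

theorem Q_mul_T_neg {i j : ℕ+} (h : ¬ A i j) : Q A i * T A j = 0 := by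
  classical
  ext f x
  rw [mul_apply_eq_comp, Q_apply, T_apply]
  by_cases h0 : x.1 0 = j
  · rw [if_neg (h0 ▸ h)]
    rfl
  · simp [h0]

theorem T_mul_Q (j : ℕ+) : T A j * (star (T A j) * T A j) = T A j := by
  classical
  rw [← mul_assoc]
  ext f x
  rw [mul_apply_eq_comp, T_mul_star_T_apply, T_apply]
  split_ifs <;> rfl

theorem star_T_mul_T_ne {i j : ℕ+} (h : i ≠ j) : star (T A i) * T A j = 0 := by
  classical
  ext f x
  rw [mul_apply_eq_comp]
  by_cases h' : A i (x.1 0)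
  · rw [star_T_apply _ _ _ h', T_apply, if_neg]
    · rfl
    · exact h
  · rw [star_T_apply_zero _ _ _ h']
    rfl

/-- Diagonal operators of `ℓ²(Σ_A)`. -/
def IsDiag (R : Hilb A →L[ℂ] Hilb A) : Prop :=
  ∀ (x : ShiftSpace A) (f : Hilb A), (R f) x = (R (basisVec x)) x * f x

theorem isDiag_of {R : Hilb A →L[ℂ] Hilb A} (c : ShiftSpace A → ℂ)
    (h : ∀ f x, (R f) x = c x * f x) : IsDiag R := by
  intro x f
  rw [h, h, basisVec_self, mul_one]

/-- The closed `*`-algebra of diagonal operators. -/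
def diagonals (A : ℕ+ → ℕ+ → Prop) : StarSubalgebra ℂ (Hilb A →L[ℂ] Hilb A) where
  carrier := {R | IsDiag R}
  mul_mem' := by
    intro R S hR hS
    refine isDiag_of (fun x => (R (basisVec x)) x * (S (basisVec x)) x) fun f x => ?_
    rw [mul_apply_eq_comp, hR, hS x f, mul_assoc]
  add_mem' := by
    intro R S hR hS
    refine isDiag_of (fun x => (R (basisVec x)) x + (S (basisVec x)) x) fun f x => ?_
    rw [add_apply, lp.coeFn_add, Pi.add_apply, hR x f, hS x f, add_mul]
  algebraMap_mem' := by
    intro r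
    refine isDiag_of (fun _ => r) fun f x => ?_
    rw [Algebra.algebraMap_eq_smul_one]
    simp
  star_mem' := by
    intro R hR
    have key : ∀ x, R (basisVec x) = (R (basisVec x)) x • basisVec x := by
      intro x
      ext y
      rw [hR y, lp.coeFn_smul, Pi.smul_apply, smul_eq_mul]
      by_cases h : y = x
      · subst h
        rfl
      · rw [basisVec_ne h, mul_zero, mul_zero]
    refine isDiag_of (fun x => starRingEnd ℂ ((R (basisVec x)) x)) fun f x => ?_
    rw [star_apply, key x, inner_smul_left, inner_basisVec, lp.coeFn_smul, Pi.smul_apply,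
      basisVec_self, smul_eq_mul, mul_one]

theorem continuous_coord (f : Hilb A) (x : ShiftSpace A) :
    Continuous fun R : Hilb A →L[ℂ] Hilb A => (R f) x := by
  have h : (fun R : Hilb A →L[ℂ] Hilb A => (R f) x)
      = fun R : Hilb A →L[ℂ] Hilb A => inner ℂ (basisVec x) (R f) := by
    funext R
    rw [inner_basisVec]
  rw [h]
  fun_prop

theorem isClosed_diagonals : IsClosed (diagonals A : Set (Hilb A →L[ℂ] Hilb A)) := by
  have h : (diagonals A : Set (Hilb A →L[ℂ] Hilb A))
      = ⋂ (x : ShiftSpace A) (f : Hilb A), {R | (R f) x = (R (basisVec x)) x * f x} := by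
    ext R
    simp only [Set.mem_iInter]
    rfl
  rw [h]
  exact isClosed_iInter fun x => isClosed_iInter fun f =>
    isClosed_eq (continuous_coord f x) ((continuous_coord _ x).mul continuous_const)

theorem Q_mem_diagonals (s : ℕ+) : Q A s ∈ diagonals A := by
  classical
  refine isDiag_of (fun x => if A s (x.1 0) then 1 else 0) fun f x => ?_
  rw [Q_apply]
  split_ifs <;> simp

theorem conj_mem_diagonals (s : ℕ+) {R : Hilb A →L[ℂ] Hilb A} (hR : R ∈ diagonals A) :
    T A s * R * star (T A s) ∈ diagonals A := by
  refine isDiag_of (fun x => if x.1 0 = s then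
    (R (basisVec (seqShift x))) (seqShift x) else 0) fun f x => ?_
  rw [mul_apply_eq_comp, mul_apply_eq_comp, T_apply]
  split_ifs with h
  · subst h
    have h' : A (x.1 0) ((seqShift x).1 0) := x.2 0
    rw [hR (seqShift x), star_T_apply _ _ _ h', consSeq_seqShift]
  · rw [zero_mul]

theorem Tword_cons (j : ℕ+) (α : List ℕ+) : Tword A (j :: α) = T A j * Tword A α := by
  simp [Tword]

theorem generators_diagonal : generators A ⊆ diagonals A := by
  rintro G ⟨α, F, rfl⟩
  induction α with
  | nil =>
    have h : (F.map (Q A)).prod ∈ diagonals A := by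
      refine list_prod_mem fun R hR => ?_
      obtain ⟨i, -, rfl⟩ := List.mem_map.1 hR
      exact Q_mem_diagonals i
    simpa [Tword] using h
  | cons j α ih =>
    have := conj_mem_diagonals j ih
    rw [Tword_cons, star_mul]
    have h : T A j * Tword A α * (F.map (Q A)).prod * (star (Tword A α) * star (T A j)) ∈
        diagonals A := by
      simpa only [mul_assoc] using this
    exact h

theorem diagAlg_le_diagonals : diagAlg A ≤ diagonals A :=
  StarSubalgebra.topologicalClosure_minimal
    (StarAlgebra.adjoin_le generators_diagonal) isClosed_diagonals

theorem diagonals_comm {R S : Hilb A →L[ℂ] Hilb A} (hR : R ∈ diagonals A) (hS : S ∈ diagonals A) :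
    R * S = S * R := by
  ext f x
  rw [mul_apply_eq_comp, mul_apply_eq_comp, hR x (S f), hS x (R f),
    hR x f, hS x f]
  ring

theorem generator_mem (α F : List ℕ+) :
    Tword A α * (F.map (Q A)).prod * star (Tword A α) ∈ diagAlg A :=
  StarSubalgebra.le_topologicalClosure _ (StarAlgebra.subset_adjoin ℂ _ ⟨α, F, rfl⟩)

theorem Q_mem (s : ℕ+) : Q A s ∈ diagAlg A := by
  simpa [Tword] using generator_mem (A := A) [] [s]

theorem P_mem (s : ℕ+) : T A s * star (T A s) ∈ diagAlg A := by
  simpa [Tword] using generator_mem (A := A) [s] []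

theorem conj_mem_of {V : Hilb A →L[ℂ] Hilb A} (hV : V * (star V * V) = V)
    (hd : star V * V ∈ diagonals A) (h1 : V * star V ∈ diagAlg A)
    (hg : ∀ G ∈ generators A, V * G * star V ∈ diagAlg A)
    {R : Hilb A →L[ℂ] Hilb A} (hR : R ∈ diagAlg A) : V * R * star V ∈ diagAlg A := by
  let S : StarSubalgebra ℂ (Hilb A →L[ℂ] Hilb A) :=
    { carrier := {R | R ∈ diagonals A ∧ V * R * star V ∈ diagAlg A}
      mul_mem' := by
        rintro R S ⟨hR, hR'⟩ ⟨hS, hS'⟩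
        refine ⟨mul_mem hR hS, ?_⟩
        have h : V * (R * S) * star V = (V * R * star V) * (V * S * star V) := by
          calc V * (R * S) * star V = V * (star V * V) * R * S * star V := by
                rw [hV]; simp only [mul_assoc]
            _ = V * ((star V * V) * R) * S * star V := by simp only [mul_assoc]
            _ = V * (R * (star V * V)) * S * star V := by rw [diagonals_comm hd hR]
            _ = _ := by simp only [mul_assoc]
        rw [h]
        exact mul_mem hR' hS'
      add_mem' := by
        rintro R S ⟨hR, hR'⟩ ⟨hS, hS'⟩
        refine ⟨add_mem hR hS, ?_⟩
        rw [mul_add, add_mul]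
        exact add_mem hR' hS'
      algebraMap_mem' := by
        intro r
        refine ⟨algebraMap_mem _ r, ?_⟩
        have h : V * algebraMap ℂ _ r * star V = r • (V * star V) := by
          rw [Algebra.algebraMap_eq_smul_one]
          simp
        rw [h]
        exact SMulMemClass.smul_mem r h1
      star_mem' := by
        rintro R ⟨hR, hR'⟩
        refine ⟨star_mem hR, ?_⟩
        have h : V * star R * star V = star (V * R * star V) := by
          simp only [star_mul, star_star, mul_assoc]
        rw [h]
        exact star_mem hR' }
  have hS : IsClosed (S : Set (Hilb A →L[ℂ] Hilb A)) := by
    refine isClosed_diagonals.inter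
      ((StarSubalgebra.isClosed_topologicalClosure (StarAlgebra.adjoin ℂ (generators A))).preimage
        (f := fun R => V * R * star V) ?_)
    fun_prop
  have hle : diagAlg A ≤ S := StarSubalgebra.topologicalClosure_minimal
    (StarAlgebra.adjoin_le fun G hG => ⟨generators_diagonal hG, hg G hG⟩) hS
  exact (hle hR).2

theorem conj_T_mem (j : ℕ+) {R : Hilb A →L[ℂ] Hilb A} (hR : R ∈ diagAlg A) :
    T A j * R * star (T A j) ∈ diagAlg A := by
  refine conj_mem_of (T_mul_Q j) (Q_mem_diagonals j) (P_mem j) ?_ hR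
  rintro G ⟨α, F, rfl⟩
  have := generator_mem (A := A) (j :: α) F
  rw [Tword_cons, star_mul] at this
  simpa only [mul_assoc] using this

theorem conj_star_T_mem (j : ℕ+) {R : Hilb A →L[ℂ] Hilb A} (hR : R ∈ diagAlg A) :
    star (T A j) * R * T A j ∈ diagAlg A := by
  have key := conj_mem_of (V := star (T A j)) ?_ ?_ ?_ ?_ hR
  · rwa [star_star] at key
  · have h := congrArg star (T_mul_Q (A := A) j)
    simpa only [star_mul, star_star, mul_assoc] using h
  · rw [star_star]
    exact diagAlg_le_diagonals (P_mem j)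
  · rw [star_star]
    exact Q_mem j
  · rintro G ⟨α, F, rfl⟩
    rw [star_star]
    cases α with
    | nil =>
      have h : (F.map (Q A)).prod * T A j = T A j ∨ (F.map (Q A)).prod * T A j = 0 := by
        induction F with
        | nil => simp
        | cons i F ih =>
          rw [List.map_cons, List.prod_cons, mul_assoc]
          rcases ih with ih | ih
          · rw [ih]
            by_cases hij : A i j
            · exact Or.inl (Q_mul_T_pos hij)
            · exact Or.inr (Q_mul_T_neg hij)
          · rw [ih, mul_zero]
            exact Or.inr rfl
      have h' : star (T A j) * (Tword A [] * (F.map (Q A)).prod * star (Tword A [])) * T A j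
          = star (T A j) * ((F.map (Q A)).prod * T A j) := by
        simp [Tword, mul_assoc]
      rw [h']
      rcases h with h | h
      · rw [h]
        exact Q_mem j
      · rw [h, mul_zero]
        exact zero_mem _
    | cons i α =>
      have h' : star (T A j) * (Tword A (i :: α) * (F.map (Q A)).prod * star (Tword A (i :: α)))
            * T A j
          = (star (T A j) * T A i) * (Tword A α * (F.map (Q A)).prod * star (Tword A α))
            * (star (T A i) * T A j) := by
        rw [Tword_cons, star_mul]
        simp only [mul_assoc]
      rw [h']
      by_cases hij : j = i
      · subst hij
        exact mul_mem (mul_mem (Q_mem j) (generator_mem α F)) (Q_mem j)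
      · rw [star_T_mul_T_ne hij, zero_mul, zero_mul]
        exact zero_mem _

theorem Tletters_cons (p : ℕ+ × Bool) (w : List (ℕ+ × Bool)) :
    Tletters A (p :: w) = (if p.2 then T A p.1 else star (T A p.1)) * Tletters A w := by
  simp [Tletters]

theorem Tletters_mem (w : List (ℕ+ × Bool)) :
    Tletters A w * star (Tletters A w) ∈ diagAlg A := by
  induction w with
  | nil => simp [Tletters]
  | cons p w ih =>
    rw [Tletters_cons, star_mul]
    obtain ⟨j, b⟩ := p
    cases b with
    | true => simpa [mul_assoc] using conj_T_mem j ih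
    | false => simpa [mul_assoc] using conj_star_T_mem j ih

theorem e_mem (g : FreeGroup ℕ+) : e A g ∈ diagAlg A := Tletters_mem _

theorem e_of (j : ℕ+) : e A (FreeGroup.of j) = T A j * star (T A j) := by
  simp [e, Tletters]

end Facts

/-! ### The space `X_A` -/

/-- Configurations `ξ ∈ {0,1}^𝔽`, where `𝔽` is the free group on the alphabet. -/
abbrev Config : Type := FreeGroup ℕ+ → Bool

/-- The spectrum of the commutative `C^*`-algebra `diagAlg A`. -/
abbrev Spec (A : ℕ+ → ℕ+ → Prop) : Type := WeakDual.characterSpace ℂ (diagAlg A)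

instance completeSpace_diagAlg (A : ℕ+ → ℕ+ → Prop) : CompleteSpace (diagAlg A) :=
  inferInstanceAs
    (CompleteSpace (StarAlgebra.adjoin ℂ (generators A)).topologicalClosure)

open Classical in
/-- The map `φ ↦ (φ(e_g))_g` from the spectrum to `{0,1}^𝔽` (each `φ(e_g)` is `0` or `1`). -/
def toConfig {A : ℕ+ → ℕ+ → Prop} (φ : Spec A) : Config :=
  fun g => decide (φ ⟨e A g, e_mem g⟩ = 1)

/-- The space `X_A`: the spectrum of `diagAlg A`, embedded in `{0,1}^𝔽`. It carries the subspace
topology of the product topology, and the corresponding Borel `σ`-algebra. -/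
def XA (A : ℕ+ → ℕ+ → Prop) : Set Config := Set.range (toConfig (A := A))

theorem borelSpace_XA (A : ℕ+ → ℕ+ → Prop) : BorelSpace (XA A) := inferInstance

/-- The character `R ↦ (R δ_x, δ_x)` given by a point `x` of `Σ_A`. -/
def evalChar {A : ℕ+ → ℕ+ → Prop} (x : ShiftSpace A) : Spec A :=
  WeakDual.CharacterSpace.equivAlgHom.symm
    { toFun := fun R => inner ℂ (basisVec x) (R.1 (basisVec x))
      map_one' := by
        rw [inner_basisVec]
        exact basisVec_self x
      map_mul' := by
        intro R S
        simp only [inner_basisVec]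
        exact diagAlg_le_diagonals R.2 x _
      map_zero' := by simp
      map_add' := by
        intro R S
        simp
      commutes' := by
        intro r
        rw [inner_basisVec]
        simp [Algebra.algebraMap_eq_smul_one, basisVec_self] }

/-- `Σ_A` as a subset of `X_A`. -/
def SigmaSet (A : ℕ+ → ℕ+ → Prop) : Set (XA A) :=
  {ξ | ∃ x : ShiftSpace A, ξ.1 = toConfig (evalChar x)}

/-- `Y_A = X_A \ Σ_A`. -/
def YA (A : ℕ+ → ℕ+ → Prop) : Set (XA A) := (SigmaSet A)ᶜ

/-- The domain of the shift: the configurations in `X_A` whose stem is not the empty word, i.e.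
those in which some letter `j` is filled. -/
def U (A : ℕ+ → ℕ+ → Prop) : Set (XA A) := {ξ | ∃ j : ℕ+, ξ.1 (FreeGroup.of j) = true}

theorem isOpen_U (A : ℕ+ → ℕ+ → Prop) : IsOpen (U A) := by
  have h : U A = ⋃ j : ℕ+, (fun ξ : XA A => ξ.1 (FreeGroup.of j)) ⁻¹' {true} := by
    ext ξ
    simp [U]
  rw [h]
  refine isOpen_iUnion fun j => (isOpen_discrete _).preimage ?_
  exact (continuous_apply _).comp continuous_subtype_val

theorem conj_eval {A : ℕ+ → ℕ+ → Prop} (φ : Spec A) (j : ℕ+) (g : FreeGroup ℕ+)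
    (hφ : φ ⟨T A j * star (T A j), P_mem j⟩ = 1) :
    φ ⟨T A j * e A g * star (T A j), conj_T_mem j (e_mem g)⟩
      = φ ⟨e A (FreeGroup.of j * g), e_mem _⟩ := by
  have hw : (FreeGroup.of j * g).toWord = FreeGroup.reduce ((j, true) :: g.toWord) := by
    rw [FreeGroup.toWord_mul, FreeGroup.toWord_of]
    rfl
  by_cases hc : ∃ w, g.toWord = (j, false) :: w
  · obtain ⟨w, hgw⟩ := hc
    have hjg : (FreeGroup.of j * g).toWord = w := by
      rw [hw, FreeGroup.reduce.cons, FreeGroup.reduce_toWord, hgw]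
      simp
    have h1 : (⟨T A j * e A g * star (T A j), conj_T_mem j (e_mem g)⟩ : diagAlg A)
        = ⟨T A j * star (T A j), P_mem j⟩ * ⟨e A (FreeGroup.of j * g), e_mem _⟩
          * ⟨T A j * star (T A j), P_mem j⟩ := by
      apply Subtype.ext
      simp only [MulMemClass.coe_mul, e, hjg, hgw, Tletters_cons, star_mul]
      simp [mul_assoc]
    rw [h1, map_mul, map_mul, hφ, one_mul, mul_one]
  · have hjg : (FreeGroup.of j * g).toWord = (j, true) :: g.toWord := by
      rw [hw, FreeGroup.reduce.cons, FreeGroup.reduce_toWord]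
      cases hgw : g.toWord with
      | nil => rfl
      | cons p w =>
        obtain ⟨i, b⟩ := p
        have hne : ¬ (j = i ∧ true = !b) := by
          rintro ⟨rfl, hb⟩
          refine hc ⟨w, ?_⟩
          cases b with
          | false => exact hgw
          | true => exact absurd hb (by decide)
        simp only
        rw [if_neg hne]
    congr 1
    apply Subtype.ext
    simp only [e, hjg, Tletters_cons, star_mul, if_true, mul_assoc]

/-- The character `R ↦ φ (T_j R T_j^*)`, for a character `φ` with `φ(e_j) = 1`. -/
def conjChar {A : ℕ+ → ℕ+ → Prop} (φ : Spec A) (j : ℕ+)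
    (hφ : φ ⟨T A j * star (T A j), P_mem j⟩ = 1) : Spec A :=
  WeakDual.CharacterSpace.equivAlgHom.symm
    { toFun := fun R => φ ⟨T A j * R.1 * star (T A j), conj_T_mem j R.2⟩
      map_one' := by
        simpa using hφ
      map_mul' := by
        intro R S
        rw [← map_mul]
        congr 1
        apply Subtype.ext
        have hc : (star (T A j) * T A j) * R.1 = R.1 * (star (T A j) * T A j) :=
          diagonals_comm (Q_mem_diagonals j) (diagAlg_le_diagonals R.2)
        calc T A j * (R.1 * S.1) * star (T A j)
            = T A j * (star (T A j) * T A j) * R.1 * S.1 * star (T A j) := by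
              rw [T_mul_Q]; simp only [mul_assoc]
          _ = T A j * ((star (T A j) * T A j) * R.1) * S.1 * star (T A j) := by
              simp only [mul_assoc]
          _ = T A j * (R.1 * (star (T A j) * T A j)) * S.1 * star (T A j) := by rw [hc]
          _ = (T A j * R.1 * star (T A j)) * (T A j * S.1 * star (T A j)) := by
              simp only [mul_assoc]
      map_zero' := by
        have h : (⟨T A j * (0 : diagAlg A).1 * star (T A j), conj_T_mem j (0 : diagAlg A).2⟩
            : diagAlg A) = 0 := by
          apply Subtype.ext
          simp
        rw [h, map_zero]
      map_add' := by
        intro R S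
        rw [← map_add]
        congr 1
        apply Subtype.ext
        simp [mul_add, add_mul]
      commutes' := by
        intro r
        have h : (⟨T A j * (algebraMap ℂ (diagAlg A) r).1 * star (T A j),
              conj_T_mem j (algebraMap ℂ (diagAlg A) r).2⟩ : diagAlg A)
            = r • ⟨T A j * star (T A j), P_mem j⟩ := by
          apply Subtype.ext
          simp [Algebra.algebraMap_eq_smul_one]
        rw [h, map_smul, hφ]
        simp }

theorem conjChar_apply {A : ℕ+ → ℕ+ → Prop} (φ : Spec A) (j : ℕ+)
    (hφ : φ ⟨T A j * star (T A j), P_mem j⟩ = 1) (S : diagAlg A) :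
    conjChar φ j hφ S = φ ⟨T A j * S.1 * star (T A j), conj_T_mem j S.2⟩ := by
  unfold conjChar
  rw [WeakDual.CharacterSpace.equivAlgHom_symm_coe]
  rfl

theorem shift_mem {A : ℕ+ → ℕ+ → Prop} {ξ : Config} (hξ : ξ ∈ XA A) {j : ℕ+}
    (hj : ξ (FreeGroup.of j) = true) : (fun g => ξ (FreeGroup.of j * g)) ∈ XA A := by
  obtain ⟨φ, rfl⟩ := hξ
  have hφ : φ ⟨T A j * star (T A j), P_mem j⟩ = 1 := by
    have h : φ ⟨e A (FreeGroup.of j), e_mem _⟩ = 1 := by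
      simpa only [toConfig, decide_eq_true_eq] using hj
    rw [← h]
    exact congrArg φ (Subtype.ext (e_of j).symm)
  refine ⟨conjChar φ j hφ, ?_⟩
  funext g
  simp only [toConfig]
  rw [conjChar_apply, ← conj_eval φ j g hφ]

/-- The shift `σ : U → X_A`, `σ(ξ)_g = ξ_{j g}`, where `j` is the first letter of the stem of `ξ`
(the only letter that is filled in `ξ`). -/
def shift (A : ℕ+ → ℕ+ → Prop) (ξ : U A) : XA A :=
  ⟨fun g => ξ.1.1 (FreeGroup.of ξ.2.choose * g), shift_mem ξ.1.2 ξ.2.choose_spec⟩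

/-- `D`-conformal measures in the sense of Denker and Urbański, for `σ : U → X` and
`D : U → [0, ∞)` with `U ⊆ X` measurable: `μ(σ(E)) = ∫_E D dμ` for every special set `E`, i.e.
for every measurable `E ⊆ U` on which `σ` is injective. -/
def IsConformal {X : Type*} [MeasurableSpace X] {V : Set X} (σ : V → X) (D : V → ℝ≥0)
    (μ : Measure X) : Prop :=
  ∀ E : Set V, MeasurableSet (Subtype.val '' E) → Set.InjOn σ E →
    μ (σ '' E) = ∫⁻ x in E, (D x : ℝ≥0∞) ∂(μ.comap Subtype.val)

/-! ### The renewal shift -/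

/-- The matrix of the renewal shift: `A(1, n) = A(n + 1, n) = 1`, and all other entries are `0`. -/
def renewal : ℕ+ → ℕ+ → Prop := fun i j => i = 1 ∨ i = j + 1

/-- The element of the free group given by a finite positive word. -/
def word (ω : List ℕ+) : FreeGroup ℕ+ := (ω.map FreeGroup.of).prod

/-- The set `R`: the empty word and the finite admissible words that end with the letter `1`. -/
def R : Set (List ℕ+) := {ω | List.IsChain renewal ω ∧ ∀ a ∈ ω.getLast?, a = 1}

open Classical in
/-- The configuration `ξ⁰`: exactly the inverses of the words in `R` are filled. -/
def xi0 : Config := fun g => decide (∃ ω ∈ R, g = (word ω)⁻¹)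

/-- The translated configuration `ω ξ⁰`, `(ω ξ⁰)_g = ξ⁰_{ω⁻¹ g}`. -/
def point (ω : List ℕ+) : Config := fun g => xi0 ((word ω)⁻¹ * g)

/-- The coefficients `c_ω = μ({ω ξ⁰})`. -/
def coeff (μ : Measure (XA renewal)) (ω : List ℕ+) : ℝ≥0∞ := μ {ξ | ξ.1 = point ω}

end RenewalShift

end

open RenewalShift

/-!
The projections `e_g` are diagonal operators: `e_g` is the indicator of the set of sequences `x` to
which the letters of `g`, read as partial maps of `Σ_A`, can be applied (`e_apply`). A character of
the diagonal algebra is multiplicative on the `e_g` and the `1 - e_g`, so its configuration agrees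
with that of some sequence on every finite set of coordinates; by compactness of the spectrum every
configuration approximated in this way is attained. Hence `X_A` is the closure of `Σ_A` in
`{0,1}^𝔽` (`mem_XA_iff`), and no further operator theory is needed.

For the renewal matrix, the configurations of sequences converge to `ξ⁰` as the first letter tends
to infinity (`exists_seqConfig_eq_xi0`): the only words that such a sequence admits prepend positive
words, and a word can be put in front of all large letters only if it ends with `1`. It follows that
`ξ⁰` is the only point of `X_A` without a filled letter, and that every `ω ξ⁰` with `ω ∈ R` lies in
`X_A`, as a limit of the sequences `ω x`. Conversely, if the filled positive words of `ξ ∈ X_A` are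
arbitrarily long, they are the prefixes of a sequence whose configuration is `ξ`; if there is a
longest one `α`, then `α⁻¹ ξ` has no filled letter, so `ξ = α ξ⁰`
(`eq_seqConfig_or_eq_point`). This describes `Y_A`, and shows that it is countable.

A measure that vanishes on `Σ_A` is therefore a sum of point masses at the `ω ξ⁰`. The shift
preserves both `Σ_A` and `Y_A`, so on a set `E` where it is injective the conformality equation is
the sum over the countable set `E ∩ Y_A` of the equations between point masses
(`isConformal_iff`), and singletons `E` give these equations back.
-/

namespace RenewalShift

/-! ### Sequences as configurations -/

section General

variable {A : ℕ+ → ℕ+ → Prop}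

/-- `Admits w x` holds when the letters of `w`, read as partial maps of `Σ_A` (a letter `j` removes
an initial `j`, a letter `j⁻¹` puts `j` in front), can be applied to `x` one after the other. The
diagonal operator `T_w T_w^*` is the indicator of `{x | Admits w x}`, see
`Tletters_mul_star_apply`. -/
def Admits : List (ℕ+ × Bool) → ShiftSpace A → Prop
  | [], _ => True
  | (j, true) :: w, x => x.1 0 = j ∧ Admits w (seqShift x)
  | (j, false) :: w, x => ∃ h : A j (x.1 0), Admits w (consSeq j x h)

@[simp] theorem admits_nil (x : ShiftSpace A) : Admits [] x ↔ True := Iff.rfl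

@[simp] theorem admits_cons_true (j : ℕ+) (w : List (ℕ+ × Bool)) (x : ShiftSpace A) :
    Admits ((j, true) :: w) x ↔ x.1 0 = j ∧ Admits w (seqShift x) := Iff.rfl

@[simp] theorem admits_cons_false (j : ℕ+) (w : List (ℕ+ × Bool)) (x : ShiftSpace A) :
    Admits ((j, false) :: w) x ↔ ∃ h : A j (x.1 0), Admits w (consSeq j x h) := Iff.rfl

open Classical in
theorem Tletters_mul_star_apply (w : List (ℕ+ × Bool)) (f : Hilb A) (x : ShiftSpace A) :
    ((Tletters A w * star (Tletters A w)) f) x = if Admits w x then f x else 0 := by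
  induction w generalizing f x with
  | nil => simp [Tletters]
  | cons p w ih =>
    obtain ⟨j, b⟩ := p
    cases b with
    | true =>
      have h : Tletters A ((j, true) :: w) * star (Tletters A ((j, true) :: w))
          = T A j * (Tletters A w * star (Tletters A w)) * star (T A j) := by
        simp [Tletters_cons, mul_assoc]
      rw [h, mul_apply_eq_comp, mul_apply_eq_comp, T_apply, ih, admits_cons_true]
      by_cases h0 : x.1 0 = j
      · subst h0
        have h' : A (x.1 0) ((seqShift x).1 0) := x.2 0
        rw [star_T_apply _ _ _ h', consSeq_seqShift]
        simp
      · simp [h0]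
    | false =>
      have h : Tletters A ((j, false) :: w) * star (Tletters A ((j, false) :: w))
          = star (T A j) * (Tletters A w * star (Tletters A w)) * T A j := by
        simp [Tletters_cons, mul_assoc]
      rw [h, mul_apply_eq_comp, mul_apply_eq_comp, admits_cons_false]
      by_cases h0 : A j (x.1 0)
      · rw [star_T_apply _ _ _ h0, ih, T_apply, if_pos (consSeq_zero j x h0)]
        simp only [h0, exists_true_left]
        rfl
      · rw [star_T_apply_zero _ _ _ h0, if_neg fun h => h0 h.1]

theorem admits_congr (w : List (ℕ+ × Bool)) {x y : ShiftSpace A}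
    (h : ∀ n ≤ w.length, x.1 n = y.1 n) : Admits w x ↔ Admits w y := by
  induction w generalizing x y with
  | nil => rfl
  | cons p w ih =>
    obtain ⟨j, b⟩ := p
    have h0 : x.1 0 = y.1 0 := h 0 (Nat.zero_le _)
    cases b with
    | true =>
      rw [admits_cons_true, admits_cons_true, h0, ih]
      intro n hn
      exact h (n + 1) (by simpa using hn)
    | false =>
      rw [admits_cons_false, admits_cons_false]
      have key : ∀ (hx : A j (x.1 0)) (hy : A j (y.1 0)),
          Admits w (consSeq j x hx) ↔ Admits w (consSeq j y hy) := fun hx hy => by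
        refine ih fun n hn => ?_
        cases n with
        | zero => rfl
        | succ n => exact h n (by simp only [List.length_cons]; omega)
      exact ⟨fun ⟨hx, hw⟩ => ⟨h0 ▸ hx, (key hx _).1 hw⟩,
        fun ⟨hy, hw⟩ => ⟨h0 ▸ hy, (key _ hy).2 hw⟩⟩

open Classical in
/-- The configuration of a sequence `x ∈ Σ_A`: `g` is filled if and only if
`δ_x` lies in the range of the projection `e_g`. -/
noncomputable def seqConfig (x : ShiftSpace A) : Config := fun g => decide (Admits g.toWord x)

theorem seqConfig_eq_true {x : ShiftSpace A} {g : FreeGroup ℕ+} :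
    seqConfig x g = true ↔ Admits g.toWord x := by
  simp [seqConfig]

theorem e_apply (g : FreeGroup ℕ+) (f : Hilb A) (x : ShiftSpace A) :
    (e A g f) x = if seqConfig x g = true then f x else 0 := by
  classical
  rw [e, Tletters_mul_star_apply]
  simp only [seqConfig_eq_true]

theorem evalChar_apply (x : ShiftSpace A) (S : diagAlg A) :
    evalChar x S = (S.1 (basisVec x)) x := by
  unfold evalChar
  rw [WeakDual.CharacterSpace.equivAlgHom_symm_coe]
  exact inner_basisVec x _

theorem evalChar_e (x : ShiftSpace A) (g : FreeGroup ℕ+) :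
    evalChar x ⟨e A g, e_mem g⟩ = if seqConfig x g = true then 1 else 0 := by
  rw [evalChar_apply, e_apply, basisVec_self]

theorem toConfig_evalChar (x : ShiftSpace A) : toConfig (evalChar x) = seqConfig x := by
  funext g
  rw [toConfig, evalChar_e]
  cases seqConfig x g <;> simp

/-- `X_A` is the closure of `Σ_A` in `{0,1}^𝔽`, stated with finite sets of coordinates.

If no point of `Σ_A` agreed with the configuration of a character `φ` on the finite set `F`, then
the product of the operators `e_g` (for filled `g ∈ F`) and `1 - e_g` (for the others) would vanish
although `φ` does not vanish on any factor. The converse is the compactness of the spectrum. -/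
theorem mem_XA_iff {ξ : Config} :
    ξ ∈ XA A ↔ ∀ F : Finset (FreeGroup ℕ+), ∃ x : ShiftSpace A, ∀ g ∈ F, seqConfig x g = ξ g := by
  constructor
  · rintro ⟨φ, rfl⟩ F
    by_contra! hF
    let q : FreeGroup ℕ+ → diagAlg A := fun g =>
      if toConfig φ g = true then ⟨e A g, e_mem g⟩ else 1 - ⟨e A g, e_mem g⟩
    have hq : ∀ g, φ (q g) ≠ 0 := by
      intro g
      by_cases h : toConfig φ g = true
      · have h' : φ ⟨e A g, e_mem g⟩ = 1 := by simpa [toConfig] using h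
        simp [q, h, h']
      · have h' : φ ⟨e A g, e_mem g⟩ ≠ 1 := by simpa [toConfig] using h
        simp only [q, if_neg h, map_sub, map_one]
        exact sub_ne_zero.2 h'.symm
    have hq' : ∀ g f (x : ShiftSpace A), ((q g).1 f) x
        = if seqConfig x g = toConfig φ g then f x else 0 := by
      intro g f x
      cases h : toConfig φ g <;> cases h2 : seqConfig x g <;> simp [q, h, h2, e_apply]
    have hprod : ∀ (l : List (FreeGroup ℕ+)) f (x : ShiftSpace A), (((l.map q).prod).1 f) x
        = if ∀ g ∈ l, seqConfig x g = toConfig φ g then f x else 0 := by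
      intro l f x
      induction l with
      | nil => simp
      | cons g l ih =>
        rw [List.map_cons, List.prod_cons, MulMemClass.coe_mul, mul_apply_eq_comp, hq', ih]
        by_cases h : seqConfig x g = toConfig φ g <;> simp [h]
    have hzero : (F.toList.map q).prod = 0 := by
      apply Subtype.ext
      ext f x
      rw [hprod, if_neg]
      · rfl
      · intro h
        obtain ⟨g, hg, hne⟩ := hF x
        exact hne (h g (Finset.mem_toList.2 hg))
    have h := congrArg φ hzero
    rw [map_list_prod, map_zero, List.prod_eq_zero_iff] at h
    simp only [List.map_map, List.mem_map] at h
    obtain ⟨g, -, hg⟩ := h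
    exact hq g hg
  · intro h
    let t : FreeGroup ℕ+ → Set (Spec A) := fun g =>
      {φ | φ ⟨e A g, e_mem g⟩ = if ξ g = true then 1 else 0}
    have hne : (⋂ g, t g).Nonempty := by
      refine CompactSpace.iInter_nonempty (fun g => ?_) fun F => ?_
      · refine isClosed_eq ?_ continuous_const
        exact (WeakDual.eval_continuous _).comp continuous_subtype_val
      · obtain ⟨x, hx⟩ := h F
        refine ⟨evalChar x, Set.mem_iInter₂.2 fun g hg => ?_⟩
        change evalChar x ⟨e A g, e_mem g⟩ = _
        rw [evalChar_e, hx g hg]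
    obtain ⟨φ, hφ⟩ := hne
    refine ⟨φ, funext fun g => ?_⟩
    have hg : φ ⟨e A g, e_mem g⟩ = if ξ g = true then 1 else 0 := Set.mem_iInter.1 hφ g
    rw [toConfig, hg]
    cases ξ g <;> simp

theorem mem_SigmaSet_iff {ξ : XA A} : ξ ∈ SigmaSet A ↔ ∃ x : ShiftSpace A, ξ.1 = seqConfig x := by
  simp only [SigmaSet, Set.mem_ofPred_eq, toConfig_evalChar]

/-! ### Positive words -/

theorem word_eq_mk (ω : List ℕ+) : word ω = FreeGroup.mk (ω.map fun a => (a, true)) := by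
  induction ω with
  | nil => rfl
  | cons a ω ih =>
    have h : word (a :: ω) = FreeGroup.of a * word ω := by simp [word]
    rw [h, ih]
    rfl

theorem toWord_word (ω : List ℕ+) : (word ω).toWord = ω.map fun a => (a, true) := by
  rw [word_eq_mk, FreeGroup.toWord_mk]
  refine FreeGroup.IsReduced.reduce_eq ?_
  rw [FreeGroup.IsReduced, List.isChain_map]
  exact List.Pairwise.isChain (List.pairwise_of_forall fun _ _ _ => rfl)

theorem toWord_word_inv (ω : List ℕ+) :
    (word ω)⁻¹.toWord = ω.reverse.map fun a => (a, false) := by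
  rw [FreeGroup.toWord_inv, toWord_word, FreeGroup.invRev]
  simp [Function.comp_def]

theorem word_injective : Function.Injective word := by
  intro α β h
  have h' := congrArg FreeGroup.toWord h
  rw [toWord_word, toWord_word] at h'
  exact List.map_injective_iff.2 (fun a b h => (Prod.ext_iff.1 h).1) h'

theorem word_nil : word [] = 1 := rfl

theorem word_cons (a : ℕ+) (ω : List ℕ+) : word (a :: ω) = FreeGroup.of a * word ω := by
  simp [word]

theorem word_append (α β : List ℕ+) : word (α ++ β) = word α * word β := by
  simp [word]

/-! ### The shift on configurations of sequences -/

theorem seqConfig_one (x : ShiftSpace A) : seqConfig x 1 = true := by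
  rw [seqConfig_eq_true, FreeGroup.toWord_one]
  trivial

theorem seqConfig_of {x : ShiftSpace A} {j : ℕ+} :
    seqConfig x (FreeGroup.of j) = true ↔ x.1 0 = j := by
  rw [seqConfig_eq_true, FreeGroup.toWord_of]
  simp

theorem seqConfig_of_mul (x : ShiftSpace A) (g : FreeGroup ℕ+) :
    seqConfig x (FreeGroup.of (x.1 0) * g) = seqConfig (seqShift x) g := by
  rw [Bool.eq_iff_iff, seqConfig_eq_true, seqConfig_eq_true]
  set j := x.1 0 with hj
  have hw : (FreeGroup.of j * g).toWord = FreeGroup.reduce ((j, true) :: g.toWord) := by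
    rw [FreeGroup.toWord_mul, FreeGroup.toWord_of]
    rfl
  by_cases hc : ∃ w, g.toWord = (j, false) :: w
  · obtain ⟨w, hgw⟩ := hc
    have hjg : (FreeGroup.of j * g).toWord = w := by
      rw [hw, FreeGroup.reduce.cons, FreeGroup.reduce_toWord, hgw]
      simp
    rw [hjg, hgw, admits_cons_false]
    have h' : A j ((seqShift x).1 0) := x.2 0
    have hx : consSeq j (seqShift x) h' = x := consSeq_seqShift x h'
    simp only [h', exists_true_left, hx]
  · have hjg : (FreeGroup.of j * g).toWord = (j, true) :: g.toWord := by
      rw [hw]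
      refine FreeGroup.IsReduced.reduce_eq ?_
      refine List.isChain_cons.2 ⟨?_, FreeGroup.isReduced_toWord⟩
      rintro ⟨i, b⟩ hib rfl
      cases b with
      | true => rfl
      | false =>
        cases hgw : g.toWord with
        | nil => simp [hgw] at hib
        | cons p w =>
          rw [hgw] at hib
          obtain rfl : p = (j, false) := by simpa using hib
          exact absurd ⟨w, hgw⟩ hc
    rw [hjg, admits_cons_true]
    exact ⟨fun h => h.2, fun h => ⟨hj.symm, h⟩⟩

/-- The first `n` letters of a sequence. -/
def initial (x : ShiftSpace A) (n : ℕ) : List ℕ+ := List.ofFn fun i : Fin n => x.1 i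

theorem length_initial (x : ShiftSpace A) (n : ℕ) : (initial x n).length = n := by
  simp [initial]

theorem initial_succ (x : ShiftSpace A) (n : ℕ) :
    initial x (n + 1) = x.1 0 :: initial (seqShift x) n := by
  rw [initial, List.ofFn_succ]
  rfl

theorem initial_eq_initial_iff {x y : ShiftSpace A} {n : ℕ} :
    initial x n = initial y n ↔ ∀ k < n, x.1 k = y.1 k := by
  rw [initial, initial, List.ofFn_inj, funext_iff]
  exact Fin.forall_iff

theorem seqConfig_word {x : ShiftSpace A} {α : List ℕ+} :
    seqConfig x (word α) = true ↔ initial x α.length = α := by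
  rw [seqConfig_eq_true, toWord_word]
  induction α generalizing x with
  | nil => simp [initial]
  | cons a α ih => simp [initial_succ, ih]

theorem seqConfig_word_initial (x : ShiftSpace A) (n : ℕ) :
    seqConfig x (word (initial x n)) = true := by
  rw [seqConfig_word, length_initial]

theorem seqConfig_word_initial_mul (x : ShiftSpace A) (n : ℕ) (g : FreeGroup ℕ+) :
    seqConfig x (word (initial x n) * g) = seqConfig (seqShift^[n] x) g := by
  induction n generalizing x with
  | zero => simp [initial, word_nil]
  | succ n ih =>
    rw [initial_succ, word_cons, mul_assoc, seqConfig_of_mul, ih, Function.iterate_succ_apply]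

theorem exists_append (ω : List ℕ+) (x : ShiftSpace A) (h : List.IsChain A (ω ++ [x.1 0])) :
    ∃ y : ShiftSpace A, initial y ω.length = ω ∧ seqShift^[ω.length] y = x := by
  suffices ∃ y : ShiftSpace A, initial y ω.length = ω ∧ seqShift^[ω.length] y = x ∧
      y.1 0 ∈ (ω ++ [x.1 0]).head? by
    obtain ⟨y, h1, h2, -⟩ := this
    exact ⟨y, h1, h2⟩
  induction ω with
  | nil => exact ⟨x, by simp [initial]⟩
  | cons a ω ih =>
    rw [List.cons_append, List.isChain_cons] at h
    obtain ⟨y, h1, h2, h3⟩ := ih h.2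
    refine ⟨consSeq a y (h.1 _ h3), ?_, ?_, rfl⟩
    · rw [List.length_cons, initial_succ]
      exact congrArg (a :: ·) h1
    · rw [List.length_cons, Function.iterate_succ_apply]
      exact h2

theorem translate_mem_XA {ξ : Config} (hξ : ξ ∈ XA A) {α : List ℕ+}
    (hα : ξ (word α) = true) : (fun g => ξ (word α * g)) ∈ XA A := by
  classical
  rw [mem_XA_iff] at hξ ⊢
  intro F
  obtain ⟨x, hx⟩ := hξ (insert (word α) (F.image (word α * ·)))
  have hxα := seqConfig_word.1 ((hx _ (Finset.mem_insert_self _ _)).trans hα)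
  refine ⟨seqShift^[α.length] x, fun g hg => ?_⟩
  rw [← seqConfig_word_initial_mul, hxα]
  exact hx _ (Finset.mem_insert_of_mem (Finset.mem_image_of_mem _ hg))

theorem apply_one_of_mem_XA {ξ : Config} (hξ : ξ ∈ XA A) : ξ 1 = true := by
  obtain ⟨x, hx⟩ := mem_XA_iff.1 hξ {1}
  rw [← hx 1 (Finset.mem_singleton_self _), seqConfig_one]

theorem letter_unique {ξ : Config} (hξ : ξ ∈ XA A) {i j : ℕ+}
    (hi : ξ (FreeGroup.of i) = true) (hj : ξ (FreeGroup.of j) = true) : i = j := by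
  classical
  obtain ⟨x, hx⟩ := mem_XA_iff.1 hξ {FreeGroup.of i, FreeGroup.of j}
  rw [← hx _ (by simp), seqConfig_of] at hi hj
  exact hi.symm.trans hj

theorem shift_apply (ξ : U A) {j : ℕ+} (hj : ξ.1.1 (FreeGroup.of j) = true)
    (g : FreeGroup ℕ+) : (shift A ξ).1 g = ξ.1.1 (FreeGroup.of j * g) := by
  rw [letter_unique ξ.1.2 hj ξ.2.choose_spec]
  rfl

/-- A configuration in `X_A` with arbitrarily long filled positive words comes from a sequence. -/
theorem exists_eq_seqConfig {ξ : Config} (hξ : ξ ∈ XA A)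
    (h : ∀ n, ∃ y : ShiftSpace A, ξ (word (initial y n)) = true) :
    ∃ x : ShiftSpace A, ξ = seqConfig x := by
  classical
  choose y hy using h
  have hcompat : ∀ n m k, k < n → k < m → (y n).1 k = (y m).1 k := by
    intro n m k hn hm
    obtain ⟨z, hz⟩ := mem_XA_iff.1 hξ {word (initial (y n) n), word (initial (y m) m)}
    have h1 := seqConfig_word.1 ((hz _ (by simp)).trans (hy n))
    have h2 := seqConfig_word.1 ((hz _ (by simp)).trans (hy m))
    rw [length_initial, initial_eq_initial_iff] at h1 h2
    rw [← h1 k hn, ← h2 k hm]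
  let x : ShiftSpace A := ⟨fun k => (y (k + 1)).1 k, fun k => by
    have h := (y (k + 1 + 1)).2 k
    rwa [hcompat (k + 1 + 1) (k + 1) k (by omega) (by omega)] at h⟩
  have hx : ∀ n, initial x n = initial (y n) n := fun n =>
    initial_eq_initial_iff.2 fun k hk => hcompat _ _ k k.lt_succ_self hk
  refine ⟨x, funext fun g => ?_⟩
  -- `seqConfig x g` depends only on the letters of `x` up to the length of `g`
  obtain ⟨N, hN⟩ : ∃ N, g.toWord.length < N := ⟨_, Nat.lt_succ_self _⟩
  obtain ⟨z, hz⟩ := mem_XA_iff.1 hξ {word (initial (y N) N), g}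
  have h1 := seqConfig_word.1 ((hz _ (by simp)).trans (hy N))
  rw [length_initial, ← hx, initial_eq_initial_iff] at h1
  rw [← hz g (by simp), Bool.eq_iff_iff, seqConfig_eq_true, seqConfig_eq_true]
  exact admits_congr _ fun n hn => h1 n (by omega)

/-- If the reduced word `w` does not start by removing the first letter of `x`, then only
negative letters occur in `w` as soon as `w` can be applied to `x`: a positive letter would
have to cancel the negative letter before it. -/
theorem admits_iff_of_isReduced (w : List (ℕ+ × Bool)) (x : ShiftSpace A)
    (hw : FreeGroup.IsReduced ((x.1 0, false) :: w)) :
    Admits w x ↔ ∃ ω : List ℕ+, w = ω.reverse.map (fun a => (a, false)) ∧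
      List.IsChain A (ω ++ [x.1 0]) := by
  induction w generalizing x with
  | nil => exact iff_of_true trivial ⟨[], by simp⟩
  | cons p w ih =>
    obtain ⟨j, b⟩ := p
    obtain ⟨h1, h2⟩ := List.isChain_cons.1 hw
    cases b with
    | true =>
      refine iff_of_false ?_ ?_
      · rintro ⟨h, -⟩
        exact absurd (h1 (j, true) rfl h) (by simp)
      · rintro ⟨ω, h, -⟩
        have hmem : (j, true) ∈ ω.reverse.map (fun a => (a, false)) := by simp [← h]
        simp at hmem
    | false =>
      rw [admits_cons_false]
      constructor
      · rintro ⟨hj, h⟩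
        obtain ⟨ω, rfl, hω⟩ := (ih (consSeq j x hj) h2).1 h
        refine ⟨ω ++ [j], by simp, ?_⟩
        refine List.isChain_append.2 ⟨hω, List.isChain_singleton _, ?_⟩
        simpa using hj
      · rintro ⟨ω, h, hω⟩
        rcases List.eq_nil_or_concat' ω with rfl | ⟨ω, a, rfl⟩
        · simp at h
        · simp only [List.reverse_append, List.reverse_cons, List.reverse_nil, List.nil_append,
            List.singleton_append, List.map_cons, List.cons.injEq, Prod.mk.injEq, and_true] at h
          obtain ⟨rfl, rfl⟩ := h
          obtain ⟨hω1, -, hω2⟩ := List.isChain_append.1 hω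
          have hj : A j (x.1 0) := by simpa using hω2
          exact ⟨hj, (ih (consSeq j x hj) h2).2 ⟨ω, rfl, hω1⟩⟩

end General

/-! ### The renewal shift -/

/-- The sequence `n, n - 1, …, 2, 1, 1, 1, …`. -/
def descending (n : ℕ+) : ShiftSpace renewal :=
  ⟨fun k => Nat.toPNat' (n - k), fun k => by
    rcases Nat.lt_or_ge (k + 1) n with h | h
    · right
      rw [← PNat.coe_inj, PNat.add_coe, Nat.toPNat'_coe, Nat.toPNat'_coe, if_pos (by omega),
        if_pos (by omega), PNat.one_coe]
      omega
    · left
      rw [← PNat.coe_inj, Nat.toPNat'_coe, PNat.one_coe]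
      split_ifs <;> omega⟩

theorem descending_zero (n : ℕ+) : (descending n).1 0 = n := by
  rw [← PNat.coe_inj]
  simp [descending]

theorem xi0_eq_true {g : FreeGroup ℕ+} : xi0 g = true ↔ ∃ ω ∈ R, g = (word ω)⁻¹ := by
  simp [xi0]

theorem mem_R_iff {ω : List ℕ+} : ω ∈ R ↔ xi0 (word ω)⁻¹ = true := by
  rw [xi0_eq_true]
  constructor
  · exact fun h => ⟨ω, h, rfl⟩
  · rintro ⟨τ, hτ, h⟩
    rwa [word_injective (inv_injective h)]

theorem nil_mem_R : [] ∈ R := ⟨List.IsChain.nil, by simp⟩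

theorem xi0_of (j : ℕ+) : xi0 (FreeGroup.of j) = false := by
  rw [Bool.eq_false_iff, Ne, xi0_eq_true]
  rintro ⟨ω, -, h⟩
  have h' := congrArg FreeGroup.toWord h
  rw [FreeGroup.toWord_of, toWord_word_inv] at h'
  have hmem : (j, true) ∈ ω.reverse.map (fun a => (a, false)) := by simp [← h']
  simp at hmem

/-- Sequences with a large first letter are close to `ξ⁰`. A word that such a sequence admits
consists of negative letters only, and the positive word which it puts in front must end with a
letter that may be followed by every large letter, that is, with `1`. -/
theorem exists_seqConfig_eq_xi0 (g : FreeGroup ℕ+) :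
    ∃ N : ℕ+, ∀ x : ShiftSpace renewal, N < x.1 0 → seqConfig x g = xi0 g := by
  obtain ⟨N, hN⟩ : ∃ N : ℕ+, ∀ p ∈ g.toWord, p.1 ≤ N := by
    obtain ⟨N, hN⟩ := (g.toWord.toFinset.image Prod.fst).bddAbove
    refine ⟨N, fun p hp => hN ?_⟩
    exact Finset.mem_coe.2 (Finset.mem_image_of_mem _ (List.mem_toFinset.2 hp))
  refine ⟨N, fun x hx => ?_⟩
  rw [Bool.eq_iff_iff, seqConfig_eq_true, xi0_eq_true, admits_iff_of_isReduced]
  · constructor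
    · rintro ⟨ω, hω, hc⟩
      obtain ⟨hc1, -, hc2⟩ := List.isChain_append.1 hc
      refine ⟨ω, ⟨hc1, fun a ha => ?_⟩, ?_⟩
      · refine (hc2 a ha _ rfl).resolve_right fun h => ?_
        have haN : a ≤ N := hN (a, false) (by
          rw [hω]
          simpa using List.mem_of_mem_getLast? ha)
        rw [h] at haN
        exact absurd (hx.trans (PNat.lt_add_right _ _)) (not_lt.2 haN)
      · rw [← FreeGroup.toWord_inj, hω, toWord_word_inv]
    · rintro ⟨ω, hω, rfl⟩
      refine ⟨ω, toWord_word_inv ω, List.isChain_append.2 ⟨hω.1, List.isChain_singleton _, ?_⟩⟩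
      exact fun a ha _ _ => Or.inl (hω.2 a ha)
  · refine List.isChain_cons.2 ⟨fun p hp h => ?_, FreeGroup.isReduced_toWord⟩
    have := hN p (List.mem_of_mem_head? hp)
    rw [← show x.1 0 = p.1 from h] at this
    exact absurd hx (not_lt.2 this)

theorem exists_forall_seqConfig_eq_xi0 (F : Finset (FreeGroup ℕ+)) :
    ∃ N : ℕ+, ∀ x : ShiftSpace renewal, N < x.1 0 → ∀ g ∈ F, seqConfig x g = xi0 g := by
  choose N hN using exists_seqConfig_eq_xi0
  obtain ⟨M, hM⟩ := (F.image N).bddAbove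
  refine ⟨M, fun x hx g hg => hN g x (lt_of_le_of_lt (hM ?_) hx)⟩
  exact Finset.mem_coe.2 (Finset.mem_image_of_mem _ hg)

theorem eq_xi0_of_forall_letter {ξ : Config} (hξ : ξ ∈ XA renewal)
    (h : ∀ j : ℕ+, ξ (FreeGroup.of j) = false) : ξ = xi0 := by
  classical
  funext g
  obtain ⟨N, hN⟩ := exists_seqConfig_eq_xi0 g
  obtain ⟨x, hx⟩ := mem_XA_iff.1 hξ (insert g ((Finset.Icc 1 N).image FreeGroup.of))
  rw [← hx g (Finset.mem_insert_self _ _)]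
  refine hN x (lt_of_not_ge fun hle => ?_)
  have h1 := hx (FreeGroup.of (x.1 0)) (Finset.mem_insert_of_mem
    (Finset.mem_image_of_mem _ (Finset.mem_Icc.2 ⟨one_le, hle⟩)))
  rw [h, seqConfig_of.2 rfl] at h1
  exact absurd h1 (by simp)

theorem point_nil : point [] = xi0 := by
  funext g
  simp [point, word_nil]

/-- `ω ξ⁰` is the limit of the sequences `ω x` as the first letter of `x` tends to infinity. -/
theorem point_mem_XA {ω : List ℕ+} (hω : ω ∈ R) : point ω ∈ XA renewal := by
  classical
  refine mem_XA_iff.2 fun F => ?_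
  obtain ⟨N, hN⟩ := exists_forall_seqConfig_eq_xi0 (F.image ((word ω)⁻¹ * ·))
  have hx : N < (descending (N + 1)).1 0 := by
    rw [descending_zero]
    exact PNat.lt_add_right _ _
  obtain ⟨y, hy1, hy2⟩ := exists_append ω (descending (N + 1))
    (List.isChain_append.2 ⟨hω.1, List.isChain_singleton _,
      fun a ha _ _ => Or.inl (hω.2 a ha)⟩)
  refine ⟨y, fun g hg => ?_⟩
  rw [point, ← hN _ hx _ (Finset.mem_image_of_mem _ hg), ← hy2, ← seqConfig_word_initial_mul, hy1,
    mul_inv_cancel_left]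

theorem xi0_mem_XA : xi0 ∈ XA renewal := point_nil ▸ point_mem_XA nil_mem_R

/-- The positive words filled in `ω ξ⁰` are prefixes of `ω`. -/
theorem exists_append_of_point_word {ω α : List ℕ+} (h : point ω (word α) = true) :
    ∃ β, ω = α ++ β := by
  obtain ⟨β, -, hβ⟩ := xi0_eq_true.1 h
  refine ⟨β, word_injective ?_⟩
  rw [word_append, inv_mul_eq_iff_eq_mul.1 hβ, inv_mul_cancel_right]

theorem point_word_self (ω : List ℕ+) : point ω (word ω) = true := by
  rw [point, inv_mul_cancel]
  exact apply_one_of_mem_XA xi0_mem_XA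

theorem point_injective : Function.Injective point := by
  intro ω τ h
  obtain ⟨β, hβ⟩ := exists_append_of_point_word (h ▸ point_word_self τ : point ω (word τ) = true)
  obtain ⟨γ, hγ⟩ := exists_append_of_point_word (h ▸ point_word_self ω : point τ (word ω) = true)
  have hlen := congrArg List.length hβ
  rw [hγ] at hlen
  simp only [List.length_append] at hlen
  rw [hγ, List.eq_nil_of_length_eq_zero (l := γ) (by omega), List.append_nil]

theorem point_ne_seqConfig (ω : List ℕ+) (x : ShiftSpace renewal) : point ω ≠ seqConfig x := by
  intro h
  have h1 := seqConfig_word_initial x (ω.length + 1)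
  rw [← h] at h1
  obtain ⟨β, hβ⟩ := exists_append_of_point_word h1
  have hlen := congrArg List.length hβ
  rw [List.length_append, length_initial] at hlen
  omega

/-- A configuration in `X_A` is either given by a sequence, or has a longest filled positive
word `α`; in the second case its translate by `α⁻¹` has no filled letter, so it is `α ξ⁰`. -/
theorem eq_seqConfig_or_eq_point {ξ : Config} (hξ : ξ ∈ XA renewal) :
    (∃ x : ShiftSpace renewal, ξ = seqConfig x) ∨ ∃ ω ∈ R, ξ = point ω := by
  classical
  by_cases h : ∀ n, ∃ y : ShiftSpace renewal, ξ (word (initial y n)) = true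
  · exact Or.inl (exists_eq_seqConfig hξ h)
  right
  rw [not_forall] at h
  have h0 : Nat.find h ≠ 0 := by
    intro h0
    have h1 := Nat.find_spec h
    rw [h0] at h1
    exact h1 ⟨descending 1, apply_one_of_mem_XA hξ⟩
  obtain ⟨m, hm⟩ := Nat.exists_eq_succ_of_ne_zero h0
  obtain ⟨y, hy⟩ := not_not.1 (Nat.find_min h (m := m) (by omega))
  have hmax := Nat.find_spec h
  rw [hm] at hmax
  set α := initial y m with hα
  have hlen : α.length = m := length_initial y m
  have htr : (fun g => ξ (word α * g)) = xi0 := by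
    refine eq_xi0_of_forall_letter (translate_mem_XA hξ hy) fun j => ?_
    rw [Bool.eq_false_iff]
    intro hj
    have hj' : ξ (word (α ++ [j])) = true := by
      rw [word_append, word_cons, word_nil, mul_one]
      exact hj
    obtain ⟨z, hz⟩ := mem_XA_iff.1 hξ {word (α ++ [j])}
    have h1 := seqConfig_word.1 ((hz _ (Finset.mem_singleton_self _)).trans hj')
    rw [List.length_append, List.length_singleton, hlen] at h1
    exact hmax ⟨z, h1.symm ▸ hj'⟩
  refine ⟨α, mem_R_iff.2 ?_, funext fun g => ?_⟩
  · rw [← htr]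
    simpa using apply_one_of_mem_XA hξ
  · rw [point, ← htr]
    simp

theorem mem_YA_iff {ξ : XA renewal} : ξ ∈ YA renewal ↔ ∃ ω ∈ R, ξ.1 = point ω := by
  rw [YA, Set.mem_compl_iff, mem_SigmaSet_iff]
  constructor
  · exact (eq_seqConfig_or_eq_point ξ.2).resolve_left
  · rintro ⟨ω, -, h⟩ ⟨x, hx⟩
    exact point_ne_seqConfig ω x (h.symm.trans hx)

theorem bijOn_point : Set.BijOn point R (Subtype.val '' YA renewal) := by
  refine ⟨fun ω hω => ⟨⟨point ω, point_mem_XA hω⟩, mem_YA_iff.2 ⟨ω, hω, rfl⟩, rfl⟩,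
    point_injective.injOn, ?_⟩
  rintro _ ⟨ξ, hξ, rfl⟩
  obtain ⟨ω, hω, h⟩ := mem_YA_iff.1 hξ
  exact ⟨ω, hω, h.symm⟩

theorem countable_YA : (YA renewal).Countable := by
  refine Set.countable_of_injective_of_countable_image Subtype.val_injective.injOn ?_
  rw [← bijOn_point.image_eq]
  exact (Set.to_countable R).image _

/-! ### The shift on `Y_A` -/

theorem tail_mem_R {ω : List ℕ+} (hω : ω ∈ R) : ω.tail ∈ R := by
  cases ω with
  | nil => exact hω
  | cons j τ =>
    refine ⟨(List.isChain_cons.1 hω.1).2, fun a ha => hω.2 a ?_⟩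
    rw [List.tail_cons] at ha
    cases τ with
    | nil => simp at ha
    | cons i τ => rwa [List.getLast?_cons_cons]

theorem point_cons_of_mul (j : ℕ+) (τ : List ℕ+) (g : FreeGroup ℕ+) :
    point (j :: τ) (FreeGroup.of j * g) = point τ g := by
  rw [point, point, word_cons, mul_inv_rev, mul_assoc, inv_mul_cancel_left]

theorem point_cons_of {j : ℕ+} {τ : List ℕ+} (hτ : τ ∈ R) :
    point (j :: τ) (FreeGroup.of j) = true := by
  rw [← mul_one (FreeGroup.of j), point_cons_of_mul]
  exact apply_one_of_mem_XA (point_mem_XA hτ)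

theorem shift_point {ω : List ℕ+} (hω : ω ∈ R) {x : U renewal} (hx : x.1.1 = point ω) :
    (shift renewal x).1 = point ω.tail := by
  cases ω with
  | nil =>
    obtain ⟨j, hj⟩ := x.2
    rw [hx, point_nil, xi0_of] at hj
    exact absurd hj (by simp)
  | cons j τ =>
    funext g
    rw [shift_apply x (j := j), hx, point_cons_of_mul, List.tail_cons]
    rw [hx]
    exact point_cons_of (tail_mem_R hω)

theorem shift_mem_YA_iff (x : U renewal) : shift renewal x ∈ YA renewal ↔ x.1 ∈ YA renewal := by
  constructor
  · intro h hx
    obtain ⟨y, hy⟩ := mem_SigmaSet_iff.1 hx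
    refine h (mem_SigmaSet_iff.2 ⟨seqShift y, funext fun g => ?_⟩)
    rw [shift_apply x (j := y.1 0) (by rw [hy, seqConfig_of]), hy, seqConfig_of_mul]
  · intro h
    obtain ⟨ω, hω, hx⟩ := mem_YA_iff.1 h
    exact mem_YA_iff.2 ⟨ω.tail, tail_mem_R hω, shift_point hω hx⟩

/-! ### Measures carried by `Y_A` -/

theorem measure_range_of_injective {ι X : Type*} [Countable ι] [MeasurableSpace X]
    [MeasurableSingletonClass X] (μ : Measure X) {f : ι → X} (hf : Function.Injective f) :
    μ (Set.range f) = ∑' i, μ {f i} := by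
  rw [← Set.iUnion_singleton_eq_range, measure_iUnion]
  · intro i j hij
    simpa using hf.ne hij
  · exact fun i => measurableSet_singleton _

theorem coeff_eq (μ : Measure (XA renewal)) {ω : List ℕ+} {ξ : XA renewal} (h : ξ.1 = point ω) :
    coeff μ ω = μ {ξ} := by
  rw [coeff]
  congr 1
  ext η
  rw [Set.mem_ofPred_eq, Set.mem_singleton_iff, ← h, Subtype.ext_iff]

theorem measure_inter_YA {μ : Measure (XA renewal)} (hμ : μ (SigmaSet renewal) = 0)
    (E : Set (XA renewal)) : μ (E ∩ YA renewal) = μ E :=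
  measure_inter_conull (by rwa [YA, compl_compl])

theorem measure_eq_tsum_coeff {μ : Measure (XA renewal)} (hμ : μ (SigmaSet renewal) = 0)
    (E : Set (XA renewal)) :
    μ E = ∑' ω : R, Set.indicator (point ⁻¹' (Subtype.val '' E)) (coeff μ) ω.1 := by
  classical
  let S : R → Set (XA renewal) := fun ω => {ξ | ξ ∈ E ∧ ξ.1 = point ω.1}
  have hS : E ∩ YA renewal = ⋃ ω, S ω := by
    ext ξ
    simp [S, mem_YA_iff]
  rw [← measure_inter_YA hμ, hS, measure_iUnion]
  · refine tsum_congr fun ω => ?_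
    by_cases h : point ω.1 ∈ Subtype.val '' E
    · rw [Set.indicator_of_mem (by exact h)]
      obtain ⟨ξ, hξ, hξω⟩ := h
      rw [coeff_eq μ hξω]
      congr 1
      ext η
      simp only [S, Set.mem_ofPred_eq, Set.mem_singleton_iff, ← hξω, Subtype.ext_iff]
      exact ⟨fun h => h.2, fun h => ⟨(Subtype.ext h : η = ξ) ▸ hξ, h⟩⟩
    · rw [Set.indicator_of_notMem (by exact h), show S ω = ∅ from ?_, measure_empty]
      exact Set.eq_empty_of_forall_notMem fun ξ hξ => h ⟨ξ, hξ.1, hξ.2⟩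
  · intro ω τ hne
    refine Set.disjoint_left.2 fun ξ h1 h2 => hne ?_
    exact Subtype.ext (point_injective (h1.2.symm.trans h2.2))
  · intro ω
    refine Set.Subsingleton.measurableSet fun ξ h1 η h2 => Subtype.ext ?_
    exact h1.2.trans h2.2.symm

theorem measurableEmbedding_val_U : MeasurableEmbedding (Subtype.val : U renewal → XA renewal) :=
  MeasurableEmbedding.subtype_coe (isOpen_U renewal).measurableSet

/-- Both sides of the conformality equation only see the countable set `E ∩ Y_A`, which the shift
maps injectively onto `σ(E) ∩ Y_A`; there the equation is a sum of equations between point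
masses. -/
theorem isConformal_iff {μ : Measure (XA renewal)} (hμ : μ (SigmaSet renewal) = 0)
    (D : U renewal → ℝ≥0) :
    IsConformal (shift renewal) D μ ↔
      ∀ ω ∈ R, ∀ x : U renewal, x.1.1 = point ω → coeff μ ω * D x = coeff μ ω.tail := by
  have hsingle : ∀ x : U renewal, μ.comap Subtype.val {x} = μ {x.1} := fun x => by
    rw [measurableEmbedding_val_U.comap_apply, Set.image_singleton]
  constructor
  · intro h ω hω x hx
    have h1 := h {x} (by rw [Set.image_singleton]; exact measurableSet_singleton _)
      (Set.injOn_singleton _ _)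
    rw [Set.image_singleton, lintegral_singleton, hsingle, ← coeff_eq μ hx,
      ← coeff_eq μ (shift_point hω hx)] at h1
    rw [h1, mul_comm]
  · intro h E hE hinj
    let E' : Set (U renewal) := E ∩ Subtype.val ⁻¹' YA renewal
    have hE' : E'.Countable :=
      (countable_YA.preimage Subtype.val_injective).mono Set.inter_subset_right
    have : Countable E' := hE'.to_subtype
    have himage : shift renewal '' E ∩ YA renewal
        = Set.range fun x : E' => shift renewal x.1 := by
      ext ξ
      constructor
      · rintro ⟨⟨x, hx, rfl⟩, hy⟩
        exact ⟨⟨x, hx, (shift_mem_YA_iff x).1 hy⟩, rfl⟩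
      · rintro ⟨⟨x, hx, hy⟩, rfl⟩
        exact ⟨⟨x, hx, rfl⟩, (shift_mem_YA_iff x).2 hy⟩
    have hae : (E : Set (U renewal)) =ᵐ[μ.comap Subtype.val] E' := by
      refine (inter_ae_eq_left_of_ae_eq_univ ?_).symm
      rw [ae_eq_univ, measurableEmbedding_val_U.comap_apply]
      refine measure_mono_null ?_ hμ
      rintro _ ⟨x, hx, rfl⟩
      exact not_not.1 hx
    rw [← measure_inter_YA hμ, himage, measure_range_of_injective, setLIntegral_congr hae,
      lintegral_countable _ hE']
    · refine tsum_congr fun x => ?_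
      obtain ⟨ω, hω, hx⟩ := mem_YA_iff.1 x.2.2
      rw [hsingle, ← coeff_eq μ hx, ← coeff_eq μ (shift_point hω hx), ← h ω hω x.1 hx, mul_comm]
    · intro x y hxy
      exact Subtype.ext (hinj x.2.1 y.2.1 hxy)

end RenewalShift

theorem mainTheorem4 :
    -- `ξ⁰` is the unique element of `X_A` with empty stem; hence `σ` is defined off `ξ⁰`
    (∀ ξ : Config, (ξ ∈ XA renewal ∧ ∀ j : ℕ+, ξ (FreeGroup.of j) = false) ↔ ξ = xi0) ∧
    -- `R = {ω : ξ⁰_{ω⁻¹} = 1}`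
    (∀ ω : List ℕ+, ω ∈ R ↔ xi0 (word ω)⁻¹ = true) ∧
    -- `ω ↦ ω ξ⁰` is a bijection from `R` onto the countable set `Y_A`
    Set.BijOn point R (Subtype.val '' YA renewal) ∧
    (YA renewal).Countable ∧
    -- the shift acts on `Y_A \ {ξ⁰}` by removing the first letter of a nonempty word in `R`
    (∀ ω ∈ R, ω ≠ [] → ∃ x : U renewal, x.1.1 = point ω ∧
      ω.tail ∈ R ∧ (shift renewal x).1 = point ω.tail) ∧
    ∀ μ : Measure (XA renewal), μ (SigmaSet renewal) = 0 →
      -- `μ(E) = ∑_{ω ∈ R} [ω ξ⁰ ∈ E] c_ω`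
      (∀ E : Set (XA renewal), MeasurableSet E →
        μ E = ∑' ω : R, Set.indicator (point ⁻¹' (Subtype.val '' E)) (coeff μ) ω.1) ∧
      -- `μ` is `D`-conformal if and only if `c_ω D(ω) = c_{σ(ω)}` for all nonempty `ω ∈ R`
      ∀ D : U renewal → ℝ≥0, Measurable D →
        (IsConformal (shift renewal) D μ ↔
          ∀ ω ∈ R, ∀ x : U renewal, x.1.1 = point ω →
            coeff μ ω * D x = coeff μ ω.tail) := by
  refine ⟨fun ξ => ⟨fun h => eq_xi0_of_forall_letter h.1 h.2, ?_⟩, fun ω => mem_R_iff, bijOn_point,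
    countable_YA, ?_, fun μ hμ => ⟨fun E _ => measure_eq_tsum_coeff hμ E,
      fun D _ => isConformal_iff hμ D⟩⟩
  · rintro rfl
    exact ⟨xi0_mem_XA, xi0_of⟩
  · intro ω hω hne
    obtain ⟨j, τ, rfl⟩ := List.exists_cons_of_ne_nil hne
    have hτ : τ ∈ R := tail_mem_R hω
    let x : U renewal := ⟨⟨point (j :: τ), point_mem_XA hω⟩, j, point_cons_of hτ⟩
    exact ⟨x, rfl, hτ, shift_point hω (x := x) rfl⟩
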